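/- Let $n\ge 1$ and let $d\ge 2$ be an even integer. Let $\mathcal F_{d,n}$ be the space of real forms (homogeneous polynomials) of degree $d$ in $n$ variables. For $f\in\mathcal F_{d,n}$ let $v(f)\in[0,\infty]$ be the Lebesgue volume of $\{x\in\mathbb R^n: f(x)\le 1\}$. Every $f\in\mathcal F_{d,n}$ can be written as $f(x)=\sum_{k=1}^r\lambda_k\,(y^k\cdot x)^d$ with $r\ge 0$, $\lambda_k\in\mathbb R$ and $y^k\in\mathbb S^{n-1}$, where $\mathbb S^{n-1}$ is the Euclidean unit sphere and $\cdot$ is the dot product. The nuclear norm of $f$ is $$\|f\|_*=\inf\Big\{\sum_{k=1}^r|\lambda_k| :\ f(x)=\sum_{k=1}^r\lambda_k\,(y^k\cdot x)^d,\ r\ge 0,\ \lambda_k\in\mathbb R,\ y^k\in\mathbb S^{n-1}\Big\}.$$ Put $b_{d,n}(x)=(x_1^2+\dots+x_n^2)^{d/2}$ and let $B_n$ be the closed Euclidean unit ball in $\mathbb R^n$, so that $\mathrm{vol}(B_n)=\sqrt{\pi}^{\,n}/\Gamma(\tfrac n2+1)$. Then $b_{d,n}/\|b_{d,n}\|_*$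 belongs to the unit ball of $\|\cdot\|_*$, and for every $f\in\mathcal F_{d,n}$ with $\|f\|_*\le 1$, $$v\!\left(\frac{b_{d,n}}{\|b_{d,n}\|_*}\right)=\left(\prod_{i=0}^{d/2-1}\frac{2i+n}{2i+1}\right)^{n/d}\frac{\sqrt{\pi}^{\,n}}{\Gamma\left(\frac n2+1\right)}\ \le\ v(f),$$ with equality if and only if $f=b_{d,n}/\|b_{d,n}\|_*$. -/

import Mathlib

open MeasureTheory

/-- The value `f(x)` of a polynomial `f` in `n` real variables at a point `x` of Euclidean space. -/
noncomputable def evalForm {n : ℕ} (f : MvPolynomial (Fin n) ℝ)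
    (x : EuclideanSpace ℝ (Fin n)) : ℝ :=
  MvPolynomial.eval (fun i => x i) f

/-- `v(f)`, the Lebesgue volume of the sublevel set `{f ≤ 1}`, a value in `[0, ∞]`. -/
noncomputable def sublevelVolume {n : ℕ} (f : MvPolynomial (Fin n) ℝ) : ENNReal :=
  volume {x : EuclideanSpace ℝ (Fin n) | evalForm f x ≤ 1}

/-- The form `b_{d,n}(x) = (x_1^2 + ... + x_n^2)^{d/2}`, used for even `d`. -/
noncomputable def euclideanForm (d n : ℕ) : MvPolynomial (Fin n) ℝ :=
  (∑ i : Fin n, MvPolynomial.X i ^ 2) ^ (d / 2)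

/-- The set of all sums `∑ |lam_k|` over the decompositions
`f(x) = ∑ lam_k (y^k · x)^d` with real `lam_k` and unit vectors `y^k`. -/
def decompositionCosts {n : ℕ} (d : ℕ) (f : MvPolynomial (Fin n) ℝ) : Set ℝ :=
  {s : ℝ | ∃ (r : ℕ) (lam : Fin r → ℝ) (y : Fin r → EuclideanSpace ℝ (Fin n)),
    (∀ k, ‖y k‖ = 1) ∧
    (∀ x : EuclideanSpace ℝ (Fin n),
      evalForm f x = ∑ k, lam k * (∑ i, y k i * x i) ^ d) ∧
    s = ∑ k, |lam k|}

/-- The nuclear norm of a form `f` of degree `d`. -/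
noncomputable def nuclearNorm {n : ℕ} (d : ℕ) (f : MvPolynomial (Fin n) ℝ) : ℝ :=
  sInf (decompositionCosts d f)

/-- The form `b_{d,n} / ‖b_{d,n}‖_*`. -/
noncomputable def normalizedEuclideanForm (d n : ℕ) : MvPolynomial (Fin n) ℝ :=
  (nuclearNorm d (euclideanForm d n))⁻¹ • euclideanForm d n

open Metric Module
open scoped ENNReal RealInnerProductSpace

/-!
In polar coordinates, a function `F` positively homogeneous of degree `d` satisfies
`vol {F ≤ 1} = vol(Bₙ) · ⨍ F(u) ^ (-n/d) dσ(u)`, a convex functional of the restriction of `F` to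
the unit sphere. The spherical mean `c` of `(y·u)^d` does not depend on the unit vector `y`, so a
form in the unit ball of the nuclear norm has spherical mean at most `c`. By Jensen's inequality for
`t ↦ t ^ (-n/d)` its sublevel set has volume at least `vol(Bₙ) · c ^ (-n/d)`, with equality only if
it is constantly `c` on the sphere, that is, equal to `c • b`.

It remains to see that `‖b‖_* = 1 / c`. The bound `‖b‖_* ≥ 1 / c` holds because `b` has spherical
mean `1`; for the converse, `c · b(x)` is the spherical mean of `u ↦ (u·x)^d`, which is a convex
combination of finitely many values because the `d`-th powers of linear forms lie in a
finite-dimensional space and the convex hull of a compact set in it is compact.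

The value of `c` comes from integrating `(y·x)^d` and `‖x‖^d` against a Gaussian: the two integrals
have the same radial factor.
-/

section ConvexHull

variable {V : Type*} [NormedAddCommGroup V] [NormedSpace ℝ V] [FiniteDimensional ℝ V]

theorem convexHull_eq_iUnion_image_stdSimplex_prod (s : Set V) :
    convexHull ℝ s = ⋃ k : Fin (finrank ℝ V + 2),
      (fun p : (Fin k → ℝ) × (Fin k → V) => ∑ i, p.1 i • p.2 i) ''
        (stdSimplex ℝ (Fin k) ×ˢ Set.univ.pi fun _ => s) := by
  refine Set.Subset.antisymm (fun x hx => ?_) (Set.iUnion_subset fun k => ?_)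
  · obtain ⟨ι, _, z, w, hz, hind, hw, hw1, rfl⟩ := eq_pos_convex_span_of_mem_convexHull hx
    have hcard : Fintype.card ι < finrank ℝ V + 2 := Nat.lt_succ_of_le <|
      hind.card_le_finrank_succ.trans (Nat.succ_le_succ (Submodule.finrank_le _))
    let e := (Fintype.equivFin ι).symm
    refine Set.mem_iUnion.2 ⟨⟨_, hcard⟩, (w ∘ e, z ∘ e),
      ⟨⟨fun i => (hw _).le, (e.sum_comp w).trans hw1⟩, fun i _ => hz ⟨_, rfl⟩⟩, ?_⟩
    exact e.sum_comp fun i => w i • z i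
  · rintro _ ⟨⟨w, z⟩, ⟨⟨hw, hw1⟩, hz⟩, rfl⟩
    exact mem_convexHull_of_exists_fintype w z hw hw1 (fun i => hz i trivial) rfl

theorem isCompact_convexHull {s : Set V} (hs : IsCompact s) : IsCompact (convexHull ℝ s) := by
  rw [convexHull_eq_iUnion_image_stdSimplex_prod]
  exact isCompact_iUnion fun k =>
    ((isCompact_stdSimplex ℝ (Fin k)).prod (isCompact_univ_pi fun _ => hs)).image (by fun_prop)

theorem average_mem_convexHull_range {X : Type*} [TopologicalSpace X] [CompactSpace X]
    [MeasurableSpace X] [OpensMeasurableSpace X] {μ : Measure X} [IsFiniteMeasure μ] [NeZero μ]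
    {φ : X → V} (hφ : Continuous φ) : ⨍ x, φ x ∂μ ∈ convexHull ℝ (Set.range φ) :=
  (convex_convexHull ℝ _).average_mem (isCompact_convexHull (isCompact_range hφ)).isClosed
    (.of_forall fun x => subset_convexHull ℝ _ (Set.mem_range_self x))
    (hφ.integrable_of_hasCompactSupport (HasCompactSupport.of_compactSpace φ))

end ConvexHull

section Jensen

variable {α : Type*} [MeasurableSpace α] {μ : Measure α} {F : α → ℝ} {c p : ℝ}

theorem one_sub_mul_lt_rpow_neg {x : ℝ} (hx : 0 < x) (hx1 : x ≠ 1) (hp : 0 < p) :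
    1 - p * (x - 1) < x ^ (-p) := by
  have hlog : Real.log x < x - 1 := Real.log_lt_sub_one_of_pos hx hx1
  calc 1 - p * (x - 1) < -p * Real.log x + 1 := by nlinarith
    _ ≤ Real.exp (-p * Real.log x) := Real.add_one_le_exp _
    _ = x ^ (-p) := by rw [Real.rpow_def_of_pos hx, mul_comm]

theorem tangent_lt_rpow_neg (hc : 0 < c) (hp : 0 < p) {t : ℝ} (ht : 0 < t) (htc : t ≠ c) :
    c ^ (-p) * (1 - p * (t / c - 1)) < t ^ (-p) := by
  have h := one_sub_mul_lt_rpow_neg (div_pos ht hc) (mt (div_eq_one_iff_eq hc.ne').1 htc) hp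
  rwa [Real.div_rpow ht.le hc.le, lt_div_iff₀' (by positivity)] at h

theorem ofReal_tangent_lt_ofReal_rpow_neg (hc : 0 < c) (hp : 0 < p) {t : ℝ} (htc : t ≠ c) :
    ENNReal.ofReal (c ^ (-p) * (1 - p * (t / c - 1))) < ENNReal.ofReal t ^ (-p) := by
  rcases le_or_gt t 0 with ht | ht
  · rw [ENNReal.ofReal_of_nonpos ht, ENNReal.zero_rpow_of_neg (neg_neg_of_pos hp)]
    exact ENNReal.ofReal_lt_top
  · rw [ENNReal.ofReal_rpow_of_pos ht]
    exact (ENNReal.ofReal_lt_ofReal_iff (by positivity)).2 (tangent_lt_rpow_neg hc hp ht htc)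

theorem ofReal_tangent_le_ofReal_rpow_neg (hc : 0 < c) (hp : 0 < p) (t : ℝ) :
    ENNReal.ofReal (c ^ (-p) * (1 - p * (t / c - 1))) ≤ ENNReal.ofReal t ^ (-p) := by
  rcases eq_or_ne t c with rfl | htc
  · rw [div_self hc.ne', sub_self, mul_zero, sub_zero, mul_one, ENNReal.ofReal_rpow_of_pos hc]
  · exact (ofReal_tangent_lt_ofReal_rpow_neg hc hp htc).le

theorem ofReal_integral_le_lintegral_ofReal (hF : Integrable F μ) :
    ENNReal.ofReal (∫ x, F x ∂μ) ≤ ∫⁻ x, ENNReal.ofReal (F x) ∂μ :=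
  calc ENNReal.ofReal (∫ x, F x ∂μ) ≤ ENNReal.ofReal (∫ x, max (F x) 0 ∂μ) :=
        ENNReal.ofReal_le_ofReal (integral_mono hF hF.pos_part fun x => le_max_left _ _)
    _ = ∫⁻ x, ENNReal.ofReal (max (F x) 0) ∂μ :=
        ofReal_integral_eq_lintegral_ofReal hF.pos_part (.of_forall fun x => le_max_right _ _)
    _ = ∫⁻ x, ENNReal.ofReal (F x) ∂μ := by simp

theorem ofReal_rpow_neg_le_lintegral_tangent [IsProbabilityMeasure μ] (hF : Integrable F μ)
    (hc : 0 < c) (hmean : ∫ x, F x ∂μ ≤ c) (hp : 0 < p) :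
    ENNReal.ofReal c ^ (-p) ≤
      ∫⁻ x, ENNReal.ofReal (c ^ (-p) * (1 - p * (F x / c - 1))) ∂μ := by
  have hdev : Integrable (fun x => p * (F x / c - 1)) μ :=
    ((hF.div_const c).sub (integrable_const 1)).const_mul p
  have hmean' : (∫ x, F x ∂μ) / c ≤ 1 := (div_le_one hc).2 hmean
  refine le_trans ?_
    (ofReal_integral_le_lintegral_ofReal (((integrable_const 1).sub hdev).const_mul _))
  rw [ENNReal.ofReal_rpow_of_pos hc, integral_const_mul,
    integral_sub (integrable_const 1) hdev, integral_const_mul,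
    integral_sub (hF.div_const c) (integrable_const 1), integral_div]
  simp only [integral_const, probReal_univ, smul_eq_mul, mul_one]
  refine ENNReal.ofReal_le_ofReal (le_mul_of_one_le_right (by positivity) ?_)
  nlinarith

theorem ofReal_rpow_neg_le_lintegral [IsProbabilityMeasure μ] (hF : Integrable F μ)
    (hc : 0 < c) (hmean : ∫ x, F x ∂μ ≤ c) (hp : 0 < p) :
    ENNReal.ofReal c ^ (-p) ≤ ∫⁻ x, ENNReal.ofReal (F x) ^ (-p) ∂μ :=
  (ofReal_rpow_neg_le_lintegral_tangent hF hc hmean hp).trans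
    (lintegral_mono fun x => ofReal_tangent_le_ofReal_rpow_neg hc hp (F x))

theorem ae_eq_const_of_lintegral_rpow_neg_eq [IsProbabilityMeasure μ] (hF : Integrable F μ)
    (hc : 0 < c) (hmean : ∫ x, F x ∂μ ≤ c) (hp : 0 < p)
    (heq : ∫⁻ x, ENNReal.ofReal (F x) ^ (-p) ∂μ = ENNReal.ofReal c ^ (-p)) :
    ∀ᵐ x ∂μ, F x = c := by
  have hle : ∀ x, ENNReal.ofReal (c ^ (-p) * (1 - p * (F x / c - 1))) ≤
      ENNReal.ofReal (F x) ^ (-p) := fun x => ofReal_tangent_le_ofReal_rpow_neg hc hp (F x)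
  have hfin : ENNReal.ofReal c ^ (-p) ≠ ∞ := by
    simp [ENNReal.ofReal_rpow_of_pos hc]
  have htangent := ae_eq_of_ae_le_of_lintegral_le (.of_forall hle)
    (ne_top_of_le_ne_top hfin (heq ▸ lintegral_mono hle))
    (hF.aemeasurable.ennreal_ofReal.pow_const _)
    (heq.trans_le (ofReal_rpow_neg_le_lintegral_tangent hF hc hmean hp))
  filter_upwards [htangent] with x hx
  by_contra hne
  exact (ofReal_tangent_lt_ofReal_rpow_neg hc hp hne).ne hx

end Jensen

section PolarCoordinates

/-- A real function is positively homogeneous of degree `p` if it scales by `r ^ p` under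
dilations by positive factors `r`. Nothing is required at the origin, and the degree is real, so
that norms raised to real powers are included. -/
def IsPosHomogeneous {E : Type*} [SMul ℝ E] (p : ℝ) (F : E → ℝ) : Prop :=
  ∀ ⦃r : ℝ⦄, 0 < r → ∀ x, F (r • x) = r ^ p * F x

theorem volumeIoiPow_univ (k : ℕ) : Measure.volumeIoiPow k Set.univ = ∞ := by
  refine ENNReal.eq_top_of_forall_nnreal_le fun t => ?_
  have hx : (0 : ℝ) < (k + 1) * t + 1 := by positivity
  calc (t : ℝ≥0∞) ≤ ENNReal.ofReal (((k + 1) * t + 1) ^ (k + 1) / (k + 1)) := by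
        rw [← ENNReal.ofReal_coe_nnreal]
        refine ENNReal.ofReal_le_ofReal ((le_div_iff₀' (by positivity)).2 ?_)
        exact (le_add_of_nonneg_right zero_le_one).trans
          (le_self_pow₀ (le_add_of_nonneg_left (by positivity)) k.succ_ne_zero)
    _ = Measure.volumeIoiPow k (Set.Iio ⟨(k + 1) * t + 1, hx⟩) :=
        (Measure.volumeIoiPow_apply_Iio k ⟨_, hx⟩).symm
    _ ≤ Measure.volumeIoiPow k Set.univ := measure_mono (Set.subset_univ _)

theorem volumeIoiPow_Iic (k : ℕ) (x : Set.Ioi (0 : ℝ)) :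
    Measure.volumeIoiPow k (Set.Iic x) = ENNReal.ofReal (x.1 ^ (k + 1) / (k + 1)) := by
  have hnull : Measure.volumeIoiPow k {x} = 0 := withDensity_absolutelyContinuous _ _ <| by
    rw [comap_subtype_coe_apply measurableSet_Ioi, Set.image_singleton, measure_singleton]
  rw [← Measure.volumeIoiPow_apply_Iio, ← Set.Iio_union_right]
  exact measure_congr (union_ae_eq_left_of_ae_eq_empty (ae_eq_empty.2 hnull))

-- For `a ≤ 0` both sides are `∞`, thanks to the convention `0 ^ (-q) = ∞` for `q > 0`.
theorem volumeIoiPow_setOf_rpow_mul_le_one (k : ℕ) {p : ℝ} (hp : 0 < p) (a : ℝ) :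
    Measure.volumeIoiPow k {r | r.1 ^ p * a ≤ 1} =
      ENNReal.ofReal a ^ (-((k + 1) / p)) * (k + 1 : ℝ≥0∞)⁻¹ := by
  rcases le_or_gt a 0 with ha | ha
  · have huniv : {r : Set.Ioi (0 : ℝ) | r.1 ^ p * a ≤ 1} = Set.univ :=
      Set.eq_univ_of_forall fun r =>
        (mul_nonpos_of_nonneg_of_nonpos (Real.rpow_nonneg r.2.le p) ha).trans zero_le_one
    rw [huniv, volumeIoiPow_univ, ENNReal.ofReal_of_nonpos ha,
      ENNReal.zero_rpow_of_neg (neg_neg_of_pos (by positivity)), ENNReal.top_mul (by simp)]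
  · let ρ : Set.Ioi (0 : ℝ) := ⟨a ^ (-p⁻¹), Real.rpow_pos_of_pos ha _⟩
    have hIic : {r : Set.Ioi (0 : ℝ) | r.1 ^ p * a ≤ 1} = Set.Iic ρ := by
      ext r
      have hr : (0 : ℝ) < r.1 := r.2
      change r.1 ^ p * a ≤ 1 ↔ r.1 ≤ a ^ (-p⁻¹)
      rw [← le_div_iff₀ ha, one_div, Real.rpow_neg ha.le, ← Real.inv_rpow ha.le,
        Real.le_rpow_inv_iff_of_pos hr.le (by positivity) hp]
    have hpow : (a ^ (-p⁻¹)) ^ (k + 1) = a ^ (-((k + 1) / p) : ℝ) := by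
      rw [← Real.rpow_natCast, ← Real.rpow_mul ha.le]
      congr 1
      push_cast
      ring
    rw [hIic, volumeIoiPow_Iic, hpow, div_eq_mul_inv, ENNReal.ofReal_mul (by positivity),
      ← ENNReal.ofReal_rpow_of_pos ha, ENNReal.ofReal_inv_of_pos (by positivity)]
    norm_cast

variable {E : Type*} [NormedAddCommGroup E] [NormedSpace ℝ E] {c p : ℝ} {F : E → ℝ}

theorem isPosHomogeneous_norm_rpow (p : ℝ) : IsPosHomogeneous p fun x : E => ‖x‖ ^ p :=
  fun r hr x => by
    beta_reduce
    rw [norm_smul, Real.norm_of_nonneg hr.le, Real.mul_rpow hr.le (norm_nonneg x)]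

theorem IsPosHomogeneous.norm_rpow_mul (hF : IsPosHomogeneous p F) {x : E} (hx : x ≠ 0) :
    ‖x‖ ^ p * F (‖x‖⁻¹ • x) = F x := by
  rw [← hF (norm_pos_iff.2 hx), smul_inv_smul₀ (norm_ne_zero_iff.2 hx)]

theorem IsPosHomogeneous.const_mul (hF : IsPosHomogeneous p F) (a : ℝ) :
    IsPosHomogeneous p fun x => a * F x :=
  fun r hr x => by
    beta_reduce
    rw [hF hr, mul_left_comm]

theorem IsPosHomogeneous.eq_const_mul_norm_rpow (hF : IsPosHomogeneous p F) (hp : 0 < p)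
    (hc : ∀ u : sphere (0 : E) 1, F u = c) (x : E) : F x = c * ‖x‖ ^ p := by
  rcases eq_or_ne x 0 with rfl | hx
  · have hzero := hF two_pos 0
    have hpow : (2 : ℝ) ^ p ≠ 1 := (Real.one_lt_rpow one_lt_two hp).ne'
    rw [smul_zero, eq_comm, mul_left_eq_self₀] at hzero
    simp [hzero.resolve_left hpow, Real.zero_rpow hp.ne']
  · rw [← hF.norm_rpow_mul hx, mul_comm]
    exact congrArg (· * _) (hc ⟨‖x‖⁻¹ • x, by simp [norm_smul, hx]⟩)

theorem exists_norm_eq_one_and_norm_smul_eq [Nontrivial E] (v : E) :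
    ∃ e : E, ‖e‖ = 1 ∧ ‖v‖ • e = v := by
  rcases eq_or_ne v 0 with rfl | hv
  · exact (exists_norm_eq E zero_le_one).imp fun e he => ⟨he, by simp⟩
  · exact ⟨‖v‖⁻¹ • v, norm_smul_inv_norm hv, smul_inv_smul₀ (norm_ne_zero_iff.2 hv) v⟩

variable [MeasurableSpace E] [BorelSpace E]

section Haar

variable [FiniteDimensional ℝ E] [Nontrivial E] (μ : Measure E) [μ.IsAddHaarMeasure]

instance : NeZero μ.toSphere := ⟨μ.toSphere_ne_zero⟩

theorem measure_setOf_le_one_eq_mul_lintegral_toSphere (hF : IsPosHomogeneous p F)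
    (hFm : Measurable F) (hp : 0 < p) :
    μ {x | F x ≤ 1} = (∫⁻ u : sphere (0 : E) 1,
      ENNReal.ofReal (F u) ^ (-(finrank ℝ E / p)) ∂μ.toSphere) * (finrank ℝ E : ℝ≥0∞)⁻¹ := by
  have hdim : finrank ℝ E - 1 + 1 = finrank ℝ E := Nat.sub_add_cancel finrank_pos
  have hmeas : MeasurableSet {q : sphere (0 : E) 1 × Set.Ioi (0 : ℝ) | q.2.1 ^ p * F q.1 ≤ 1} :=
    measurableSet_le (by fun_prop) measurable_const
  have himage : ((↑) : ({0}ᶜ : Set E) → E) '' {x | F x ≤ 1} = {x | F x ≤ 1} \ {0} := by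
    rw [Set.sdiff_eq, Set.inter_comm]
    exact Subtype.image_preimage_coe {0}ᶜ {x | F x ≤ 1}
  have hpreimage : {x : ({0}ᶜ : Set E) | F x ≤ 1} = homeomorphUnitSphereProd E ⁻¹'
      {q | q.2.1 ^ p * F q.1 ≤ 1} := by
    ext x
    simp [hF.norm_rpow_mul x.2]
  rw [← measure_sdiff_null (s := {x | F x ≤ 1}) (measure_singleton 0), ← himage,
    ← comap_subtype_coe_apply (measurableSet_singleton _).compl, hpreimage,
    μ.measurePreserving_homeomorphUnitSphereProd.measure_preimage hmeas.nullMeasurableSet,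
    Measure.prod_apply hmeas, ← lintegral_mul_const _ (by fun_prop)]
  refine lintegral_congr fun u => ?_
  have hradial := volumeIoiPow_setOf_rpow_mul_le_one (finrank ℝ E - 1) hp (F u)
  rwa [← Nat.cast_add_one, ← Nat.cast_add_one, hdim] at hradial

theorem measure_setOf_le_one_eq_mul_laverage (hF : IsPosHomogeneous p F) (hFm : Measurable F)
    (hp : 0 < p) :
    μ {x | F x ≤ 1} = μ (ball 0 1) *
      ⨍⁻ u : sphere (0 : E) 1, ENNReal.ofReal (F u) ^ (-(finrank ℝ E / p)) ∂μ.toSphere := by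
  have hball : μ (ball (0 : E) 1) ≠ 0 := isOpen_ball.measure_ne_zero μ (by simp)
  rw [measure_setOf_le_one_eq_mul_lintegral_toSphere μ hF hFm hp, laverage_eq,
    μ.toSphere_apply_univ, ENNReal.div_eq_inv_mul,
    ENNReal.mul_inv (.inr measure_ball_lt_top.ne) (.inr hball), mul_left_comm, ← mul_assoc,
    ENNReal.inv_mul_cancel_right hball measure_ball_lt_top.ne, mul_comm]

theorem integral_fun_norm_mul_eq_integral_toSphere_mul (hF : IsPosHomogeneous p F)
    (g : ℝ → ℝ) :
    ∫ x, g ‖x‖ * F x ∂μ = (∫ u : sphere (0 : E) 1, F u ∂μ.toSphere) *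
      ∫ r : Set.Ioi (0 : ℝ), g r * r.1 ^ p ∂Measure.volumeIoiPow (finrank ℝ E - 1) :=
  calc ∫ x, g ‖x‖ * F x ∂μ = ∫ x : ({0}ᶜ : Set E), g ‖x.1‖ * F x ∂μ.comap (↑) := by
        rw [integral_subtype_comap (measurableSet_singleton _).compl fun x => g ‖x‖ * F x,
          restrict_compl_singleton]
    _ = ∫ q, F q.1 * (g q.2 * q.2.1 ^ p)
          ∂μ.toSphere.prod (Measure.volumeIoiPow (finrank ℝ E - 1)) := by
        rw [← μ.measurePreserving_homeomorphUnitSphereProd.integral_comp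
          (Homeomorph.measurableEmbedding _)]
        refine integral_congr_ae (.of_forall fun x => ?_)
        simp only [homeomorphUnitSphereProd_apply_fst_coe, homeomorphUnitSphereProd_apply_snd_coe]
        rw [← hF.norm_rpow_mul x.2]
        ring
    _ = _ := integral_prod_mul (fun u : sphere (0 : E) 1 => F u) fun r : Set.Ioi (0 : ℝ) =>
        g r * r.1 ^ p

theorem integral_fun_norm_mul_eq_average_mul (hF : IsPosHomogeneous p F) (g : ℝ → ℝ) :
    ∫ x, g ‖x‖ * F x ∂μ =
      (⨍ u : sphere (0 : E) 1, F u ∂μ.toSphere) * ∫ x, g ‖x‖ * ‖x‖ ^ p ∂μ := by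
  have hsphere : ∫ u : sphere (0 : E) 1, ‖(u : E)‖ ^ p ∂μ.toSphere =
      μ.toSphere.real Set.univ := by simp
  rw [integral_fun_norm_mul_eq_integral_toSphere_mul μ hF,
    integral_fun_norm_mul_eq_integral_toSphere_mul μ (isPosHomogeneous_norm_rpow p), hsphere,
    average_eq, smul_eq_mul]
  have hne : μ.toSphere.real Set.univ ≠ 0 := measureReal_univ_ne_zero
  field_simp

end Haar

end PolarCoordinates

section Moments

theorem gamma_add_natCast {s : ℝ} (hs : 0 < s) (m : ℕ) :
    Real.Gamma (s + m) = (∏ i ∈ Finset.range m, (s + i)) * Real.Gamma s := by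
  induction m with
  | zero => simp
  | succ m ih =>
    rw [Finset.prod_range_succ, Nat.cast_succ, ← add_assoc,
      Real.Gamma_add_one (by positivity), ih]
    ring

theorem integral_Ioi_pow_mul_exp_neg_sq (k : ℕ) :
    ∫ t in Set.Ioi (0 : ℝ), t ^ k * Real.exp (-t ^ 2) = Real.Gamma ((k + 1) / 2) / 2 := by
  have h := integral_rpow_mul_exp_neg_rpow (p := 2) (q := k) two_pos
    (by linarith [k.cast_nonneg (α := ℝ)])
  simp only [Real.rpow_natCast, Real.rpow_two] at h
  rw [h, one_div_mul_eq_div]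

variable {E : Type*} [NormedAddCommGroup E] [InnerProductSpace ℝ E]

theorem isPosHomogeneous_inner_pow (v : E) (k : ℕ) :
    IsPosHomogeneous k fun x => ⟪v, x⟫ ^ k :=
  fun r _ x => by
    beta_reduce
    rw [inner_smul_right, mul_pow, Real.rpow_natCast]

variable [MeasurableSpace E] [BorelSpace E] [FiniteDimensional ℝ E]

theorem integral_exp_neg_norm_sq_mul_norm_pow [Nontrivial E] (m : ℕ) :
    ∫ x : E, Real.exp (-‖x‖ ^ 2) * ‖x‖ ^ (2 * m) =
      (∏ i ∈ Finset.range m, ((finrank ℝ E : ℝ) / 2 + i)) * ∫ x : E, Real.exp (-‖x‖ ^ 2) := by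
  have hdim : (0 : ℝ) < finrank ℝ E := by exact_mod_cast finrank_pos (R := ℝ) (M := E)
  have hpolar (k : ℕ) : ∫ x : E, Real.exp (-‖x‖ ^ 2) * ‖x‖ ^ (2 * k) =
      finrank ℝ E * (volume.real (ball (0 : E) 1) *
        (Real.Gamma (finrank ℝ E / 2 + k) / 2)) := by
    have hexp : ((finrank ℝ E - 1 + 2 * k : ℕ) + 1 : ℝ) / 2 = finrank ℝ E / 2 + k := by
      push_cast [Nat.cast_sub (finrank_pos (R := ℝ) (M := E))]
      ring
    rw [integral_fun_norm_addHaar volume fun r => Real.exp (-r ^ 2) * r ^ (2 * k), ← hexp,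
      ← integral_Ioi_pow_mul_exp_neg_sq, nsmul_eq_mul, smul_eq_mul]
    simp only [smul_eq_mul, pow_add, mul_assoc, mul_comm (Real.exp _)]
  have hzero := hpolar 0
  simp only [mul_zero, pow_zero, mul_one, Nat.cast_zero, add_zero] at hzero
  rw [hpolar, hzero, gamma_add_natCast (by positivity)]
  ring

theorem integral_exp_neg_norm_sq_mul_apply_pow {ι : Type*} [Fintype ι] (i₀ : ι) (m : ℕ) :
    ∫ x : EuclideanSpace ℝ ι, Real.exp (-‖x‖ ^ 2) * x i₀ ^ (2 * m) =
      (∏ i ∈ Finset.range m, (1 / 2 + i : ℝ)) *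
        ∫ x : EuclideanSpace ℝ ι, Real.exp (-‖x‖ ^ 2) := by
  classical
  have hline : ∫ t : ℝ, Real.exp (-t ^ 2) * t ^ (2 * m) =
      (∏ i ∈ Finset.range m, (1 / 2 + i : ℝ)) * ∫ t : ℝ, Real.exp (-t ^ 2) := by
    simpa [pow_mul] using integral_exp_neg_norm_sq_mul_norm_pow (E := ℝ) m
  have hprod (w : ι → ℝ → ℝ) :
      ∫ x : EuclideanSpace ℝ ι, Real.exp (-‖x‖ ^ 2) * ∏ i, w i (x i) =
        ∏ i, ∫ t, Real.exp (-t ^ 2) * w i t := by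
    rw [← integral_fintype_prod_volume_eq_prod,
      ← (PiLp.volume_preserving_toLp ι).integral_comp
        (MeasurableEquiv.toLp 2 (ι → ℝ)).measurableEmbedding]
    simp only [EuclideanSpace.norm_sq_eq, Real.norm_eq_abs, sq_abs, ← Finset.sum_neg_distrib,
      Real.exp_sum, Finset.prod_mul_distrib]
  have hpow := hprod fun i t => if i = i₀ then t ^ (2 * m) else 1
  have hone := hprod fun _ _ => 1
  have hfactor (i : ι) : ∫ t : ℝ, Real.exp (-t ^ 2) * (if i = i₀ then t ^ (2 * m) else 1) =
      (if i = i₀ then ∏ j ∈ Finset.range m, (1 / 2 + j : ℝ) else 1) *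
        ∫ t : ℝ, Real.exp (-t ^ 2) * 1 := by
    split_ifs <;> simp [hline]
  simp only [hfactor, Finset.prod_mul_distrib, Finset.prod_ite_eq', Finset.mem_univ,
    if_true, ← hone] at hpow
  simpa using hpow

theorem integral_exp_neg_norm_sq_mul_inner_pow {e : E} (he : ‖e‖ = 1) (m : ℕ) :
    ∫ x : E, Real.exp (-‖x‖ ^ 2) * ⟪e, x⟫ ^ (2 * m) =
      (∏ i ∈ Finset.range m, (1 / 2 + i : ℝ)) * ∫ x : E, Real.exp (-‖x‖ ^ 2) := by
  have hone : Orthonormal ℝ ((↑) : ({e} : Set E) → E) :=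
    ⟨fun x => by rw [Set.mem_singleton_iff.1 x.2, he], fun x y hxy =>
      absurd (Subsingleton.elim x y) hxy⟩
  obtain ⟨s, b, hes, hb⟩ := hone.exists_orthonormalBasis_extension
  have hrepr (g : EuclideanSpace ℝ s → ℝ) : ∫ x, g (b.repr x) = ∫ x, g x :=
    b.measurePreserving_repr.integral_comp b.repr.toHomeomorph.measurableEmbedding g
  have hcoord (x : E) : b.repr x ⟨e, hes rfl⟩ = ⟪e, x⟫ := by rw [b.repr_apply_apply, hb]
  have hmoment := integral_exp_neg_norm_sq_mul_apply_pow (⟨e, hes rfl⟩ : s) m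
  rw [← hrepr, ← hrepr] at hmoment
  simpa only [LinearIsometryEquiv.norm_map, hcoord] using hmoment

theorem integral_exp_neg_norm_sq_pos : 0 < ∫ x : E, Real.exp (-‖x‖ ^ 2) := by
  have h := GaussianFourier.integral_rexp_neg_mul_sq_norm (V := E) one_pos
  simp only [neg_mul, one_mul, div_one] at h
  rw [h]
  positivity

/-- The mean over the unit sphere of an `n`-dimensional Euclidean space of the `2m`-th power of
the inner product with a fixed unit vector, given in closed form. -/
noncomputable def sphereMoment (n m : ℕ) : ℝ :=
  ∏ i ∈ Finset.range m, (2 * (i : ℝ) + 1) / (2 * (i : ℝ) + n)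

theorem sphereMoment_pos (n m : ℕ) [NeZero n] : 0 < sphereMoment n m := by
  have hn : (0 : ℝ) < n := by exact_mod_cast NeZero.pos n
  exact Finset.prod_pos fun i _ => by positivity

theorem average_inner_pow_of_norm_eq_one [Nontrivial E] {e : E} (he : ‖e‖ = 1) (m : ℕ) :
    ⨍ u : sphere (0 : E) 1, ⟪e, (u : E)⟫ ^ (2 * m) ∂volume.toSphere =
      sphereMoment (finrank ℝ E) m := by
  have hpolar := integral_fun_norm_mul_eq_average_mul volume (isPosHomogeneous_inner_pow e (2 * m))
    fun r => Real.exp (-r ^ 2)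
  have hdim : (0 : ℝ) < finrank ℝ E := by exact_mod_cast finrank_pos (R := ℝ) (M := E)
  have hpos : 0 < ∏ i ∈ Finset.range m, ((finrank ℝ E : ℝ) / 2 + i) :=
    Finset.prod_pos fun i _ => by positivity
  simp only [Real.rpow_natCast] at hpolar
  rw [integral_exp_neg_norm_sq_mul_inner_pow he, integral_exp_neg_norm_sq_mul_norm_pow,
    ← mul_assoc, mul_left_inj' integral_exp_neg_norm_sq_pos.ne', ← div_eq_iff hpos.ne',
    ← Finset.prod_div_distrib] at hpolar
  rw [← hpolar, sphereMoment]
  exact Finset.prod_congr rfl fun i _ => by field_simp; ring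

theorem average_inner_pow [Nontrivial E] (v : E) (m : ℕ) :
    ⨍ u : sphere (0 : E) 1, ⟪v, (u : E)⟫ ^ (2 * m) ∂volume.toSphere =
      sphereMoment (finrank ℝ E) m * ‖v‖ ^ (2 * m) := by
  obtain ⟨e, he, hv⟩ := exists_norm_eq_one_and_norm_smul_eq v
  have hinner (x : E) : ⟪v, x⟫ ^ (2 * m) = ⟪e, x⟫ ^ (2 * m) * ‖v‖ ^ (2 * m) := by
    rw [← mul_pow, mul_comm ⟪e, x⟫, ← real_inner_smul_left, hv]
  simp only [hinner, ← average_inner_pow_of_norm_eq_one he, average_eq', integral_mul_const]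

end Moments

section Quadrature

variable {E : Type*} [NormedAddCommGroup E] [InnerProductSpace ℝ E]

theorem inner_pow_eq_sum_prod_mul_prod {ι : Type*} [Fintype ι] (b : OrthonormalBasis ι ℝ E)
    (u x : E) (d : ℕ) :
    ⟪u, x⟫ ^ d = ∑ k : Fin d → ι, (∏ j, ⟪b (k j), u⟫) * ∏ j, ⟪b (k j), x⟫ := by
  simp only [← b.sum_inner_mul_inner u x, Fintype.sum_pow, Finset.prod_mul_distrib,
    real_inner_comm u]

theorem exists_sum_mul_inner_pow_eq_average [FiniteDimensional ℝ E] [MeasurableSpace E]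
    [BorelSpace E] (μ : Measure (sphere (0 : E) 1)) [IsFiniteMeasure μ] [NeZero μ] (d : ℕ) :
    ∃ (ι : Type) (_ : Fintype ι) (w : ι → ℝ) (y : ι → E), (∀ k, 0 ≤ w k) ∧ ∑ k, w k = 1 ∧
      (∀ k, ‖y k‖ = 1) ∧ ∀ x, ∑ k, w k * ⟪y k, x⟫ ^ d = ⨍ u, ⟪(u : E), x⟫ ^ d ∂μ := by
  let b := stdOrthonormalBasis ℝ E
  let φ (u : E) : (Fin d → Fin (finrank ℝ E)) → ℝ := fun k => ∏ j, ⟪b (k j), u⟫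
  have hφ : Continuous fun u : sphere (0 : E) 1 => φ u := by fun_prop
  let L (x : E) : ((Fin d → Fin (finrank ℝ E)) → ℝ) →L[ℝ] ℝ :=
    ∑ k, φ x k • ContinuousLinearMap.proj k
  have hL (u x : E) : L x (φ u) = ⟪u, x⟫ ^ d := by
    simp [L, φ, inner_pow_eq_sum_prod_mul_prod b u x, mul_comm]
  obtain ⟨ι, _, w, z, hw, hw1, hz, hsum⟩ :=
    mem_convexHull_iff_exists_fintype.1 (average_mem_convexHull_range (μ := μ) hφ)
  choose y hy using hz
  refine ⟨ι, inferInstance, w, fun k => y k, hw, hw1, fun k => norm_eq_of_mem_sphere (y k),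
    fun x => ?_⟩
  calc ∑ k, w k * ⟪(y k : E), x⟫ ^ d = L x (∑ k, w k • z k) := by
        simp only [map_sum, map_smul, smul_eq_mul, ← hy, hL]
    _ = ⨍ u, L x (φ u) ∂μ := by
        rw [hsum, average_eq', average_eq', ContinuousLinearMap.integral_comp_comm]
        exact hφ.integrable_of_hasCompactSupport (HasCompactSupport.of_compactSpace _)
    _ = ⨍ u, ⟪(u : E), x⟫ ^ d ∂μ := by simp only [hL]

end Quadrature

section PowersOfLinearForms

open MvPolynomial

theorem sum_smul_X_pow_eq_sum_monomial {σ R : Type*} [Fintype σ] [DecidableEq σ] [CommSemiring R]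
    (a : σ → R) (d : ℕ) :
    (∑ i, a i • X i : MvPolynomial σ R) ^ d =
      ∑ k ∈ Finset.univ.finsuppAntidiag d,
        ((k.multinomial : R) * k.prod fun i j => a i ^ j) • monomial k 1 := by
  ext k
  rw [coeff_linearCombination_X_pow_of_fintype, coeff_sum]
  simp [coeff_smul, coeff_monomial, Finset.mem_finsuppAntidiag, Finsupp.sum_fintype]

theorem mem_span_range_sum_smul_X_pow {σ K : Type*} [Fintype σ] [Field K] [CharZero K] {d : ℕ}
    {f : MvPolynomial σ K} (hf : f.IsHomogeneous d) :
    f ∈ Submodule.span K (Set.range fun y : σ → K => (∑ i, y i • X i) ^ d) := by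
  classical
  -- If a functional `φ` vanishes on the span, then so does the polynomial function
  -- `y ↦ φ ((∑ i, y i • X i) ^ d)`, whose coefficients are nonzero multiples of `φ` at monomials.
  by_contra hmem
  obtain ⟨φ, hφf, hφ⟩ := Submodule.exists_le_ker_of_notMem hmem
  let P : MvPolynomial σ K := ∑ k ∈ Finset.univ.finsuppAntidiag d,
    monomial k ((k.multinomial : K) * φ (monomial k 1))
  have hP : P = 0 := MvPolynomial.funext fun y => by
    have hy : φ ((∑ i, y i • X i) ^ d) = 0 :=
      LinearMap.mem_ker.1 (hφ (Submodule.subset_span ⟨y, rfl⟩))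
    rw [map_zero, ← hy, sum_smul_X_pow_eq_sum_monomial, map_sum, map_sum]
    refine Finset.sum_congr rfl fun k _ => ?_
    rw [map_smul, eval_monomial, smul_eq_mul, mul_right_comm]
  have hmonomial {k : σ →₀ ℕ} (hk : k.degree = d) : φ (monomial k 1) = 0 := by
    have hcoeff := congrArg (coeff k) hP
    have hmult : (k.multinomial : K) ≠ 0 := by
      exact_mod_cast (Nat.multinomial_pos k.support k).ne'
    simpa [P, coeff_sum, coeff_monomial, Finset.mem_finsuppAntidiag, hmult,
      ← Finsupp.degree_eq_sum, hk] using hcoeff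
  refine hφf ?_
  rw [f.as_sum, map_sum]
  refine Finset.sum_eq_zero fun k hk => ?_
  have hdeg : k.degree = d := not_not.1 (mt hf.coeff_eq_zero (mem_support_iff.1 hk))
  rw [← mul_one (coeff k f), ← smul_eq_mul, ← smul_monomial, map_smul, hmonomial hdeg, smul_zero]

end PowersOfLinearForms

section Minimality

variable {E : Type*} [NormedAddCommGroup E] [NormedSpace ℝ E] [MeasurableSpace E] [BorelSpace E]
  [FiniteDimensional ℝ E] [Nontrivial E] (μ : Measure E) [μ.IsAddHaarMeasure]
  {F : E → ℝ} {c p : ℝ}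

theorem mul_ofReal_rpow_neg_le_measure_setOf_le_one (hF : IsPosHomogeneous p F)
    (hFc : Continuous F) (hp : 0 < p) (hc : 0 < c)
    (hmean : ⨍ u : sphere (0 : E) 1, F u ∂μ.toSphere ≤ c) :
    μ (ball 0 1) * ENNReal.ofReal c ^ (-(finrank ℝ E / p)) ≤ μ {x | F x ≤ 1} := by
  have hdim : (0 : ℝ) < finrank ℝ E := by exact_mod_cast finrank_pos (R := ℝ) (M := E)
  rw [measure_setOf_le_one_eq_mul_laverage μ hF hFc.measurable hp]
  gcongr
  exact ofReal_rpow_neg_le_lintegral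
    ((hFc.comp continuous_subtype_val).integrable_of_hasCompactSupport
      (HasCompactSupport.of_compactSpace _)) hc hmean (div_pos hdim hp)

theorem measure_setOf_mul_norm_rpow_le_one (c : ℝ) (hp : 0 < p) :
    μ {x | c * ‖x‖ ^ p ≤ 1} = μ (ball 0 1) * ENNReal.ofReal c ^ (-(finrank ℝ E / p)) := by
  rw [measure_setOf_le_one_eq_mul_laverage μ ((isPosHomogeneous_norm_rpow p).const_mul c)
    (by fun_prop) hp]
  simp [laverage_const]

theorem measure_setOf_le_one_eq_iff (hF : IsPosHomogeneous p F) (hFc : Continuous F) (hp : 0 < p)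
    (hc : 0 < c) (hmean : ⨍ u : sphere (0 : E) 1, F u ∂μ.toSphere ≤ c) :
    μ {x | F x ≤ 1} = μ (ball 0 1) * ENNReal.ofReal c ^ (-(finrank ℝ E / p)) ↔
      ∀ x, F x = c * ‖x‖ ^ p := by
  refine ⟨fun heq => hF.eq_const_mul_norm_rpow hp ?_, fun h => ?_⟩
  · have hdim : (0 : ℝ) < finrank ℝ E := by exact_mod_cast finrank_pos (R := ℝ) (M := E)
    have hFs : Continuous fun u : sphere (0 : E) 1 => F u := hFc.comp continuous_subtype_val
    rw [measure_setOf_le_one_eq_mul_laverage μ hF hFc.measurable hp,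
      ENNReal.mul_right_inj (isOpen_ball.measure_ne_zero μ (by simp)) measure_ball_lt_top.ne] at heq
    have hae := ae_eq_const_of_lintegral_rpow_neg_eq
      (hFs.integrable_of_hasCompactSupport (HasCompactSupport.of_compactSpace _)) hc hmean
      (div_pos hdim hp) heq
    rw [Measure.ae_ennreal_smul_measure_eq (ENNReal.inv_ne_zero.2 (measure_ne_top _ _))] at hae
    exact congrFun (hFs.ae_eq_iff_eq μ.toSphere continuous_const |>.1 hae)
  · simp only [h, measure_setOf_mul_norm_rpow_le_one μ c hp]

end Minimality

section NuclearNorm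

open MvPolynomial

variable {d m n : ℕ} {f : MvPolynomial (Fin n) ℝ}

theorem sum_apply_mul_apply_eq_inner {ι : Type*} [Fintype ι] (v x : EuclideanSpace ℝ ι) :
    ∑ i, v i * x i = ⟪v, x⟫ := by
  simp [PiLp.inner_apply, mul_comm]

theorem evalForm_smul (a : ℝ) (f : MvPolynomial (Fin n) ℝ) (x : EuclideanSpace ℝ (Fin n)) :
    evalForm (a • f) x = a * evalForm f x :=
  smul_eval _ f a

theorem evalForm_euclideanForm (x : EuclideanSpace ℝ (Fin n)) :
    evalForm (euclideanForm (2 * m) n) x = ‖x‖ ^ (2 * m) := by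
  simp [evalForm, euclideanForm, pow_mul, EuclideanSpace.norm_sq_eq]

theorem isHomogeneous_euclideanForm (m n : ℕ) :
    (euclideanForm (2 * m) n).IsHomogeneous (2 * m) := by
  rw [euclideanForm, Nat.mul_div_cancel_left _ two_pos]
  exact (IsHomogeneous.sum _ _ _ fun i _ => isHomogeneous_X_pow i 2).pow m

theorem continuous_evalForm (f : MvPolynomial (Fin n) ℝ) : Continuous (evalForm f) :=
  f.continuous_eval.comp (by fun_prop)

theorem evalForm_injective : Function.Injective (evalForm (n := n)) := fun _ _ h =>
  MvPolynomial.funext fun x => congrFun h (WithLp.toLp 2 x)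

theorem sum_abs_mem_decompositionCosts {ι : Type*} [Fintype ι] {w : ι → ℝ}
    {y : ι → EuclideanSpace ℝ (Fin n)} (hy : ∀ k, ‖y k‖ = 1)
    (hf : ∀ x, evalForm f x = ∑ k, w k * ⟪y k, x⟫ ^ d) : ∑ k, |w k| ∈ decompositionCosts d f := by
  let e := (Fintype.equivFin ι).symm
  refine ⟨_, w ∘ e, y ∘ e, fun k => hy (e k), fun x => ?_, (e.sum_comp fun k => |w k|).symm⟩
  simp only [sum_apply_mul_apply_eq_inner, hf, Function.comp_apply]
  exact (e.sum_comp fun k => w k * ⟪y k, x⟫ ^ d).symm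

theorem bddBelow_decompositionCosts (d : ℕ) (f : MvPolynomial (Fin n) ℝ) :
    BddBelow (decompositionCosts d f) := by
  refine ⟨0, ?_⟩
  rintro _ ⟨r, w, y, -, -, rfl⟩
  exact Finset.sum_nonneg fun _ _ => abs_nonneg _

variable [NeZero n]

theorem decompositionCosts_nonempty (hf : f.IsHomogeneous d) :
    (decompositionCosts d f).Nonempty := by
  obtain ⟨a, ha⟩ := Finsupp.mem_span_range_iff_exists_finsupp.1 (mem_span_range_sum_smul_X_pow hf)
  choose e he hnorm using fun y : a.support =>
    exists_norm_eq_one_and_norm_smul_eq (WithLp.toLp 2 (y : Fin n → ℝ))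
  refine ⟨_, sum_abs_mem_decompositionCosts
    (w := fun y : a.support => a y * ‖WithLp.toLp 2 y.1‖ ^ d) he fun x => ?_⟩
  have hinner (y : a.support) :
      ‖WithLp.toLp 2 y.1‖ ^ d * ⟪e y, x⟫ ^ d = (∑ i, y.1 i * x i) ^ d := by
    rw [← mul_pow, ← real_inner_smul_left, hnorm, ← sum_apply_mul_apply_eq_inner]
  simp only [mul_assoc, hinner]
  rw [Finset.sum_coe_sort a.support fun y => a y * (∑ i, y i * x i) ^ d, ← ha]
  simp [evalForm, Finsupp.sum, smul_eval]

theorem isPosHomogeneous_evalForm (hf : f.IsHomogeneous d) : IsPosHomogeneous d (evalForm f) := by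
  obtain ⟨_, r, w, y, -, hdecomp, -⟩ := decompositionCosts_nonempty hf
  intro t ht x
  simp only [hdecomp, sum_apply_mul_apply_eq_inner, Finset.mul_sum]
  exact Finset.sum_congr rfl fun k _ => (isPosHomogeneous_inner_pow (y k) d).const_mul (w k) ht x

theorem average_evalForm_le_mul_sphereMoment {s : ℝ} (hs : s ∈ decompositionCosts (2 * m) f) :
    ⨍ u : sphere (0 : EuclideanSpace ℝ (Fin n)) 1, evalForm f u ∂volume.toSphere ≤
      s * sphereMoment n m := by
  obtain ⟨r, w, y, hy, hf, rfl⟩ := hs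
  have hmoment (k : Fin r) := average_inner_pow_of_norm_eq_one (hy k) m
  rw [finrank_euclideanSpace_fin] at hmoment
  simp only [average_eq'] at hmoment ⊢
  simp only [hf, sum_apply_mul_apply_eq_inner]
  rw [integral_finsetSum _ fun k _ => Continuous.integrable_of_hasCompactSupport (by fun_prop)
    (HasCompactSupport.of_compactSpace _), Finset.sum_mul]
  simp only [integral_const_mul, hmoment]
  have hc := sphereMoment_pos n m
  gcongr
  exact le_abs_self _

theorem average_evalForm_le_nuclearNorm_mul (hf : f.IsHomogeneous (2 * m)) :
    ⨍ u : sphere (0 : EuclideanSpace ℝ (Fin n)) 1, evalForm f u ∂volume.toSphere ≤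
      nuclearNorm (2 * m) f * sphereMoment n m := by
  rw [← div_le_iff₀ (sphereMoment_pos n m)]
  exact le_csInf (decompositionCosts_nonempty hf) fun s hs =>
    (div_le_iff₀ (sphereMoment_pos n m)).2 (average_evalForm_le_mul_sphereMoment hs)

theorem mem_decompositionCosts_smul_euclideanForm (m n : ℕ) [NeZero n] {a : ℝ} (ha : 0 ≤ a) :
    a ∈ decompositionCosts (2 * m) ((a * sphereMoment n m) • euclideanForm (2 * m) n) := by
  obtain ⟨ι, _, w, y, hw, hw1, hy, hsum⟩ := exists_sum_mul_inner_pow_eq_average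
    (volume : Measure (EuclideanSpace ℝ (Fin n))).toSphere (2 * m)
  convert sum_abs_mem_decompositionCosts (w := fun k => a * w k) hy fun x => ?_
  · simp only [abs_mul, abs_of_nonneg ha, abs_of_nonneg (hw _), ← Finset.mul_sum, hw1, mul_one]
  · have hmoment := average_inner_pow x m
    simp only [fun u => real_inner_comm u x, finrank_euclideanSpace_fin] at hmoment
    simp only [mul_assoc, ← Finset.mul_sum, hsum, hmoment, evalForm_smul, evalForm_euclideanForm]

theorem nuclearNorm_euclideanForm (m n : ℕ) [NeZero n] :
    nuclearNorm (2 * m) (euclideanForm (2 * m) n) = (sphereMoment n m)⁻¹ := by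
  have hc := sphereMoment_pos n m
  refine le_antisymm (csInf_le (bddBelow_decompositionCosts _ _) ?_) ?_
  · simpa only [inv_mul_cancel₀ hc.ne', one_smul] using
      mem_decompositionCosts_smul_euclideanForm m n (inv_pos.2 hc).le
  · have hmean := average_evalForm_le_nuclearNorm_mul (isHomogeneous_euclideanForm m n)
    simp only [evalForm_euclideanForm, norm_eq_of_mem_sphere, one_pow, average_const] at hmean
    exact (inv_le_iff_one_le_mul₀ hc).2 hmean

theorem normalizedEuclideanForm_eq_smul (m n : ℕ) [NeZero n] :
    normalizedEuclideanForm (2 * m) n = sphereMoment n m • euclideanForm (2 * m) n := by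
  rw [normalizedEuclideanForm, nuclearNorm_euclideanForm, inv_inv]

theorem evalForm_normalizedEuclideanForm (x : EuclideanSpace ℝ (Fin n)) :
    evalForm (normalizedEuclideanForm (2 * m) n) x = sphereMoment n m * ‖x‖ ^ (2 * m) := by
  rw [normalizedEuclideanForm_eq_smul, evalForm_smul, evalForm_euclideanForm]

theorem isHomogeneous_normalizedEuclideanForm (m n : ℕ) :
    (normalizedEuclideanForm (2 * m) n).IsHomogeneous (2 * m) := by
  rw [normalizedEuclideanForm, smul_eq_C_mul]
  exact (isHomogeneous_euclideanForm m n).C_mul _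

theorem nuclearNorm_normalizedEuclideanForm_le_one (m n : ℕ) [NeZero n] :
    nuclearNorm (2 * m) (normalizedEuclideanForm (2 * m) n) ≤ 1 := by
  have hmem := mem_decompositionCosts_smul_euclideanForm m n zero_le_one
  rw [one_mul, ← normalizedEuclideanForm_eq_smul] at hmem
  exact csInf_le (bddBelow_decompositionCosts _ _) hmem

theorem eq_normalizedEuclideanForm_iff :
    f = normalizedEuclideanForm (2 * m) n ↔
      ∀ x, evalForm f x = sphereMoment n m * ‖x‖ ^ (2 * m) := by
  simp only [← evalForm_injective.eq_iff, funext_iff, evalForm_normalizedEuclideanForm]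

end NuclearNorm

section SublevelVolume

variable {m n : ℕ} [NeZero n] {f : MvPolynomial (Fin n) ℝ}

theorem sublevelVolume_normalizedEuclideanForm (hm : m ≠ 0) :
    sublevelVolume (normalizedEuclideanForm (2 * m) n) =
      volume (ball (0 : EuclideanSpace ℝ (Fin n)) 1) *
        ENNReal.ofReal (sphereMoment n m) ^ (-((n : ℝ) / (2 * m : ℕ))) := by
  have h := measure_setOf_mul_norm_rpow_le_one
    (volume : Measure (EuclideanSpace ℝ (Fin n))) (sphereMoment n m)
    (p := (2 * m : ℕ)) (by positivity)
  simpa only [Real.rpow_natCast, finrank_euclideanSpace_fin, sublevelVolume,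
    evalForm_normalizedEuclideanForm] using h

theorem volume_ball_zero_one_mul_ofReal_rpow_neg {c p : ℝ} (hc : 0 < c) :
    volume (ball (0 : EuclideanSpace ℝ (Fin n)) 1) * ENNReal.ofReal c ^ (-p) =
      ENNReal.ofReal (c⁻¹ ^ p * (√Real.pi ^ n / Real.Gamma (n / 2 + 1))) := by
  rw [EuclideanSpace.volume_ball, ENNReal.ofReal_rpow_of_pos hc, Real.inv_rpow hc.le,
    ← Real.rpow_neg hc.le, ENNReal.ofReal_mul (by positivity), mul_comm]
  simp

theorem average_evalForm_le_sphereMoment (hf : f.IsHomogeneous (2 * m))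
    (hf1 : nuclearNorm (2 * m) f ≤ 1) :
    ⨍ u : sphere (0 : EuclideanSpace ℝ (Fin n)) 1, evalForm f u ∂volume.toSphere ≤
      sphereMoment n m :=
  (average_evalForm_le_nuclearNorm_mul hf).trans
    (mul_le_of_le_one_left (sphereMoment_pos n m).le hf1)

theorem sublevelVolume_normalizedEuclideanForm_le (hm : m ≠ 0) (hf : f.IsHomogeneous (2 * m))
    (hf1 : nuclearNorm (2 * m) f ≤ 1) :
    sublevelVolume (normalizedEuclideanForm (2 * m) n) ≤ sublevelVolume f := by
  have h := mul_ofReal_rpow_neg_le_measure_setOf_le_one volume (isPosHomogeneous_evalForm hf)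
    (continuous_evalForm f) (by positivity) (sphereMoment_pos n m)
    (average_evalForm_le_sphereMoment hf hf1)
  rwa [finrank_euclideanSpace_fin, ← sublevelVolume_normalizedEuclideanForm hm] at h

theorem sublevelVolume_eq_normalizedEuclideanForm_iff (hm : m ≠ 0) (hf : f.IsHomogeneous (2 * m))
    (hf1 : nuclearNorm (2 * m) f ≤ 1) :
    sublevelVolume f = sublevelVolume (normalizedEuclideanForm (2 * m) n) ↔
      f = normalizedEuclideanForm (2 * m) n := by
  have h := measure_setOf_le_one_eq_iff volume (isPosHomogeneous_evalForm hf)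
    (continuous_evalForm f) (by positivity) (sphereMoment_pos n m)
    (average_evalForm_le_sphereMoment hf hf1)
  simp only [Real.rpow_natCast] at h
  rwa [finrank_euclideanSpace_fin, ← sublevelVolume_normalizedEuclideanForm hm,
    ← eq_normalizedEuclideanForm_iff] at h

end SublevelVolume

theorem mainTheorem4 (n d : ℕ) (hn : 1 ≤ n) (hd : Even d) (hd0 : 0 < d) :
    -- the nuclear norm is an infimum over a nonempty set for every form of degree `d`
    (∀ f : MvPolynomial (Fin n) ℝ, f.IsHomogeneous d → (decompositionCosts d f).Nonempty) ∧
    -- `b / ‖b‖_*` is a form of degree `d` in the unit ball of the nuclear norm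
    ((normalizedEuclideanForm d n).IsHomogeneous d ∧
      nuclearNorm d (normalizedEuclideanForm d n) ≤ 1) ∧
    -- the volume of its sublevel set
    sublevelVolume (normalizedEuclideanForm d n) =
      ENNReal.ofReal
        ((∏ i ∈ Finset.range (d / 2), (2 * (i : ℝ) + n) / (2 * (i : ℝ) + 1)) ^ ((n : ℝ) / (d : ℝ))
          * (Real.sqrt Real.pi ^ n / Real.Gamma ((n : ℝ) / 2 + 1))) ∧
    volume (Metric.closedBall (0 : EuclideanSpace ℝ (Fin n)) 1) =
      ENNReal.ofReal (Real.sqrt Real.pi ^ n / Real.Gamma ((n : ℝ) / 2 + 1)) ∧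
    -- it is the unique minimizer
    (∀ f : MvPolynomial (Fin n) ℝ, f.IsHomogeneous d → nuclearNorm d f ≤ 1 →
      sublevelVolume (normalizedEuclideanForm d n) ≤ sublevelVolume f ∧
      (sublevelVolume f = sublevelVolume (normalizedEuclideanForm d n) ↔
        f = normalizedEuclideanForm d n)) := by
  obtain ⟨m, rfl⟩ := hd.two_dvd
  have hm : m ≠ 0 := by omega
  have : NeZero n := ⟨by omega⟩
  refine ⟨fun f hf => decompositionCosts_nonempty hf, ⟨isHomogeneous_normalizedEuclideanForm m n,
    nuclearNorm_normalizedEuclideanForm_le_one m n⟩, ?_, ?_, fun f hf hf1 =>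
      ⟨sublevelVolume_normalizedEuclideanForm_le hm hf hf1,
        sublevelVolume_eq_normalizedEuclideanForm_iff hm hf hf1⟩⟩
  · rw [sublevelVolume_normalizedEuclideanForm hm,
      volume_ball_zero_one_mul_ofReal_rpow_neg (sphereMoment_pos n m), sphereMoment,
      ← Finset.prod_inv_distrib, Nat.mul_div_cancel_left _ two_pos]
    simp only [inv_div]
  · simp [EuclideanSpace.volume_closedBall]
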